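/- Let $\Bbbk$ be a field, $n, d \ge 0$ integers, $P=\Bbbk[x_1,\dots,x_n]$ with the standard grading, and $Q=P/(x_1^2,\dots,x_n^2)$ the Kruskal–Katona ring with the induced grading. Let $A$ be one of the graded rings $P$, $Q$. For a homogeneous ideal $I\subseteq A$, let $H(I,j)=\dim_{\Bbbk} I_j$ be the dimension of its degree-$j$ component. An ideal $I \subseteq A$ is called $d$-Gotzmann if it is homogeneous, generated by elements of degree $d$, and satisfies \[ H(I,d+1)\le H(J,d+1)\quad\text{for every homogeneous ideal } J\subseteq A \text{ with } H(J,d)=H(I,d). \] If $I\subseteq P$ is a $d$-Gotzmann ideal of $P$ that is generated by square-free monomials, then the image of $I$ in $Q$ is a $d$-Gotzmann ideal of $Q$. -/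

import Mathlib

open MvPolynomial

attribute [local instance] MvPolynomial.gradedAlgebra

namespace Gotzmann

section General

variable {k A : Type*} [Field k] [CommRing A] [Algebra k A]

/-- The Hilbert function `H(I, d) = dim_k I_d` of an ideal `I` of a graded `k`-algebra
`A = ⨁ 𝒜 d`, where `I_d = I ∩ 𝒜 d`. -/
noncomputable def hilbertFunction (𝒜 : ℕ → Submodule k A) (I : Ideal A) (d : ℕ) : ℕ :=
  Module.finrank k (I.restrictScalars k ⊓ 𝒜 d : Submodule k A)

/-- The ideal `I` is generated by elements that are homogeneous of degree `d`. -/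
def IsGeneratedInDegree (𝒜 : ℕ → Submodule k A) (d : ℕ) (I : Ideal A) : Prop :=
  ∃ S : Set A, S ⊆ 𝒜 d ∧ I = Ideal.span S

/-- `I` is a `d`-Gotzmann ideal of the graded algebra `A = ⨁ 𝒜 d`: a homogeneous ideal generated
in degree `d` such that `H(I, d + 1) ≤ H(J, d + 1)` for all homogeneous ideals `J` of `A`
with `H(I, d) = H(J, d)`. -/
def IsGotzmann (𝒜 : ℕ → Submodule k A) [GradedAlgebra 𝒜] (d : ℕ) (I : Ideal A) : Prop :=
  I.IsHomogeneous 𝒜 ∧ IsGeneratedInDegree 𝒜 d I ∧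
    ∀ J : Ideal A, J.IsHomogeneous 𝒜 →
      hilbertFunction 𝒜 I d = hilbertFunction 𝒜 J d →
        hilbertFunction 𝒜 I (d + 1) ≤ hilbertFunction 𝒜 J (d + 1)

/-- The grading induced on a quotient `A ⧸ I`: the degree `d` part is the image of `𝒜 d`. -/
def quotientGrading (𝒜 : ℕ → Submodule k A) (I : Ideal A) (d : ℕ) : Submodule k (A ⧸ I) :=
  (𝒜 d).map (Ideal.Quotient.mkₐ k I).toLinearMap

theorem mk_mem_quotientGrading (𝒜 : ℕ → Submodule k A) (I : Ideal A) {d : ℕ} {a : A}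
    (ha : a ∈ 𝒜 d) : Ideal.Quotient.mk I a ∈ quotientGrading 𝒜 I d :=
  ⟨a, ha, rfl⟩

instance quotientGrading_gradedMonoid (𝒜 : ℕ → Submodule k A) [GradedAlgebra 𝒜] (I : Ideal A) :
    SetLike.GradedMonoid (quotientGrading 𝒜 I) where
  one_mem := ⟨1, SetLike.GradedOne.one_mem, map_one (Ideal.Quotient.mk I)⟩
  mul_mem := by
    rintro i j _ _ ⟨a, ha, rfl⟩ ⟨b, hb, rfl⟩
    exact ⟨a * b, SetLike.GradedMul.mul_mem ha hb, map_mul (Ideal.Quotient.mk I) a b⟩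

/-- Auxiliary map: decompose in `A`, then reduce each component modulo `I`. -/
noncomputable def preDecompose (𝒜 : ℕ → Submodule k A) [GradedAlgebra 𝒜] (I : Ideal A) :
    A →+ DirectSum ℕ (fun i => quotientGrading 𝒜 I i) :=
  (DirectSum.toAddMonoid fun i =>
    (DirectSum.of (fun i => quotientGrading 𝒜 I i) i).comp
      (AddMonoidHom.mk' (fun a : 𝒜 i =>
        (⟨Ideal.Quotient.mk I a, mk_mem_quotientGrading 𝒜 I a.2⟩ : quotientGrading 𝒜 I i))
        (fun a b => Subtype.ext (map_add (Ideal.Quotient.mk I) (a : A) (b : A))))).comp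
    (DirectSum.decomposeAddEquiv 𝒜).toAddMonoidHom

theorem preDecompose_of_mem (𝒜 : ℕ → Submodule k A) [GradedAlgebra 𝒜] (I : Ideal A) {i : ℕ}
    {a : A} (ha : a ∈ 𝒜 i) :
    preDecompose 𝒜 I a = DirectSum.of (fun i => quotientGrading 𝒜 I i) i
      ⟨Ideal.Quotient.mk I a, mk_mem_quotientGrading 𝒜 I ha⟩ := by
  simp [preDecompose, DirectSum.decompose_of_mem 𝒜 ha]

theorem preDecompose_eq_zero (𝒜 : ℕ → Submodule k A) [GradedAlgebra 𝒜] (I : Ideal A)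
    (hI : I.IsHomogeneous 𝒜) {a : A} (ha : a ∈ I) : preDecompose 𝒜 I a = 0 := by
  classical
  rw [← DirectSum.sum_support_decompose 𝒜 a, map_sum]
  refine Finset.sum_eq_zero fun i _ => ?_
  rw [preDecompose_of_mem 𝒜 I (SetLike.coe_mem (DirectSum.decompose 𝒜 a i))]
  convert map_zero (DirectSum.of (fun i => quotientGrading 𝒜 I i) i) using 2
  exact Subtype.ext (Ideal.Quotient.eq_zero_iff_mem.2 (hI i ha))

/-- The decomposition map of the quotient of a graded algebra by a homogeneous ideal. -/
noncomputable def quotientDecompose (𝒜 : ℕ → Submodule k A) [GradedAlgebra 𝒜] (I : Ideal A)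
    (hI : I.IsHomogeneous 𝒜) : A ⧸ I →+ DirectSum ℕ (fun i => quotientGrading 𝒜 I i) :=
  QuotientAddGroup.lift (Submodule.toAddSubgroup I) (preDecompose 𝒜 I)
    (fun _ ha => preDecompose_eq_zero 𝒜 I hI ha)

theorem quotientDecompose_mk (𝒜 : ℕ → Submodule k A) [GradedAlgebra 𝒜] (I : Ideal A)
    (hI : I.IsHomogeneous 𝒜) (a : A) :
    quotientDecompose 𝒜 I hI (Ideal.Quotient.mk I a) = preDecompose 𝒜 I a :=
  rfl

/-- The quotient of a graded algebra by a homogeneous ideal is graded. -/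
noncomputable abbrev quotientGradedAlgebra (𝒜 : ℕ → Submodule k A) [GradedAlgebra 𝒜]
    (I : Ideal A) (hI : I.IsHomogeneous 𝒜) : GradedAlgebra (quotientGrading 𝒜 I) where
  toDecomposition := DirectSum.Decomposition.ofAddHom (quotientGrading 𝒜 I)
    (quotientDecompose 𝒜 I hI)
    (by
      classical
      ext q
      obtain ⟨a, rfl⟩ := Ideal.Quotient.mk_surjective q
      rw [AddMonoidHom.comp_apply, quotientDecompose_mk, AddMonoidHom.id_apply]
      conv_rhs => rw [← DirectSum.sum_support_decompose 𝒜 a]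
      conv_lhs => rw [← DirectSum.sum_support_decompose 𝒜 a]
      simp only [map_sum]
      refine Finset.sum_congr rfl fun i _ => ?_
      rw [preDecompose_of_mem 𝒜 I (SetLike.coe_mem (DirectSum.decompose 𝒜 a i)),
        DirectSum.coeAddMonoidHom_of])
    (by
      refine DirectSum.addHom_ext fun i x => ?_
      obtain ⟨_, a, ha, rfl⟩ := x
      rw [AddMonoidHom.comp_apply, DirectSum.coeAddMonoidHom_of]
      exact preDecompose_of_mem 𝒜 I ha)

end General

section KruskalKatonaRing

variable (k : Type*) [Field k] (n : ℕ)

/-- The ideal `(x_1 ^ 2, …, x_n ^ 2)` of `k[x_1, …, x_n]`. -/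
noncomputable def squaresIdeal : Ideal (MvPolynomial (Fin n) k) :=
  Ideal.span (Set.range fun i : Fin n => (X i : MvPolynomial (Fin n) k) ^ 2)

theorem squaresIdeal_isHomogeneous :
    (squaresIdeal k n).IsHomogeneous (homogeneousSubmodule (Fin n) k) := by
  refine Ideal.homogeneous_span _ _ ?_
  rintro _ ⟨i, rfl⟩
  exact ⟨2, isHomogeneous_X_pow i 2⟩

/-- The Kruskal-Katona ring `Q = k[x_1, …, x_n] / (x_1 ^ 2, …, x_n ^ 2)`. -/
abbrev KruskalKatonaRing : Type _ := MvPolynomial (Fin n) k ⧸ squaresIdeal k n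

/-- The standard grading of the Kruskal-Katona ring. -/
noncomputable abbrev kruskalKatonaGrading : ℕ → Submodule k (KruskalKatonaRing k n) :=
  quotientGrading (homogeneousSubmodule (Fin n) k) (squaresIdeal k n)

noncomputable instance kruskalKatonaGradedAlgebra : GradedAlgebra (kruskalKatonaGrading k n) :=
  quotientGradedAlgebra _ _ (squaresIdeal_isHomogeneous k n)

variable {k n}

/-- `I` is generated by square-free monomials `∏_{i ∈ F} x_i`. -/
def IsSquarefreeMonomialIdeal (I : Ideal (MvPolynomial (Fin n) k)) : Prop :=
  ∃ S : Set (Finset (Fin n)),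
    I = Ideal.span ((fun F : Finset (Fin n) => ∏ i ∈ F, (X i : MvPolynomial (Fin n) k)) '' S)

end KruskalKatonaRing

end Gotzmann

/-! Everything reduces to counting sets. Fix a monomial order. A space of polynomials has as many
dimensions as leading exponents (`finrank_eq_ncard_leadExps`), so pulling an ideal `J` of `Q` back
to `P` and discarding the exponents already led by the squares identifies `H(J, j)` with the number
of square-free leading monomials of the preimage (`hilbertFunction_eq_ncard_leadSets`).

The link between the two rings is `ncard_multiples`: for a family `T` of `d`-sets, the ideal of `P`
it generates has dimension `d * |T| + |upper shadow of T|` in degree `d + 1`. The non-square-free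
part depends only on `|T|`, so at fixed `|T|` minimal growth in `P` means minimal upper shadow.

Let `T` generate `I`, and let `W` be the square-free leading sets of `J` in degree `d`, with `|W| =
|T|`. The Gotzmann property in `P`, tested only against the monomial ideal of `W`, says that the
shadow of `T` is no larger than that of `W`. The latter lies among the leading sets of `J` in degree
`d + 1`. -/

namespace Gotzmann

/-! ### Leading exponents and dimension -/

section LeadingExponents

variable {σ k : Type*} [Field k]

/-- The leading exponents of the nonzero elements of a space of polynomials. -/
def leadExps (m : MonomialOrder σ) (U : Submodule k (MvPolynomial σ k)) : Set (σ →₀ ℕ) :=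
  {a | ∃ f ∈ U, f ≠ 0 ∧ m.degree f = a}

theorem leadExps_mono (m : MonomialOrder σ) {U V : Submodule k (MvPolynomial σ k)} (h : U ≤ V) :
    leadExps m U ⊆ leadExps m V :=
  fun _ ⟨f, hf, h0, hd⟩ => ⟨f, h hf, h0, hd⟩

/-- The dimension of a space of polynomials is the number of its leading exponents. -/
theorem finrank_eq_ncard_leadExps (m : MonomialOrder σ) (U : Submodule k (MvPolynomial σ k)) :
    Module.finrank k U = (leadExps m U).ncard := by
  classical
  choose f hfU hf0 hfd using fun a : leadExps m U => a.2
  have hcoeff : ∀ a b : leadExps m U, m.toSyn b.1 < m.toSyn a.1 → (f b).coeff a.1 = 0 :=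
    fun a b h => m.coeff_eq_zero_of_lt (by rw [hfd b]; exact h)
  have hlead : ∀ a : leadExps m U, (f a).coeff a.1 ≠ 0 := fun a h => by
    have := m.coeff_degree_ne_zero_iff.2 (hf0 a)
    rw [hfd a] at this
    exact this h
  let v : leadExps m U → U := fun a => ⟨f a, hfU a⟩
  have hli : LinearIndependent k v := by
    rw [linearIndependent_iff']
    intro s g hg
    by_contra! hne
    obtain ⟨i, his, hi⟩ := hne
    -- The largest leading exponent in a relation cannot be cancelled by the other terms.
    obtain ⟨a, ha, hmax⟩ := Finset.exists_max_image (s.filter fun a => g a ≠ 0)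
      (fun a => m.toSyn a.1) ⟨i, by simp [his, hi]⟩
    rw [Finset.mem_filter] at ha
    have h1 := congrArg (fun u : U => (u : MvPolynomial σ k).coeff a.1) hg
    simp only [Submodule.coe_sum, Submodule.coe_smul, coeff_sum, coeff_smul, smul_eq_mul,
      Submodule.coe_zero, coeff_zero, v] at h1
    rw [Finset.sum_eq_single a] at h1
    · exact mul_ne_zero ha.2 (hlead a) h1
    · intro b hb hba
      by_cases hgb : g b = 0
      · rw [hgb, zero_mul]
      · rw [hcoeff a b, mul_zero]
        refine lt_of_le_of_ne (hmax b (by simp [hb, hgb])) fun h => hba ?_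
        exact Subtype.ext (m.toSyn.injective h)
    · exact fun h => (h ha.1).elim
  have key : ∀ s : m.syn, ∀ u : U, m.toSyn (m.degree (u : MvPolynomial σ k)) = s →
      u ∈ Submodule.span k (Set.range v) := by
    intro s
    induction s using WellFoundedLT.induction with
    | ind s ih =>
      intro u hu
      by_cases hu0 : (u : MvPolynomial σ k) = 0
      · rw [show u = 0 from Subtype.ext hu0]
        exact zero_mem _
      · let a : leadExps m U := ⟨m.degree (u : MvPolynomial σ k), u, u.2, hu0, rfl⟩
        -- This scalar cancels the leading term of `u`, so the induction on leading exponents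
        -- descends.
        let c := (u : MvPolynomial σ k).coeff a.1 / (f a).coeff a.1
        have hva : v a ∈ Submodule.span k (Set.range v) := Submodule.subset_span ⟨a, rfl⟩
        suffices h : u - c • v a ∈ Submodule.span k (Set.range v) by
          simpa using add_mem h (Submodule.smul_mem _ c hva)
        by_cases hz : ((u - c • v a : U) : MvPolynomial σ k) = 0
        · rw [show u - c • v a = 0 from Subtype.ext hz]
          exact zero_mem _
        refine ih _ ?_ _ rfl
        rw [← hu]
        refine lt_of_le_of_ne ?_ fun h => ?_
        · refine (m.degree_sub_le (f := (u : MvPolynomial σ k))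
            (g := c • f a)).trans (sup_le le_rfl ?_)
          refine m.degree_smul_le.trans ?_
          rw [hfd a]
        · have h2 := m.coeff_degree_ne_zero_iff.2 hz
          rw [m.toSyn.injective h] at h2
          apply h2
          change coeff a.1 ((u : MvPolynomial σ k) - c • f a) = 0
          rw [coeff_sub, coeff_smul, smul_eq_mul, div_mul_cancel₀ _ (hlead a), sub_self]
  -- No finiteness is needed: for an infinite basis both sides take the default value 0.
  rw [Module.finrank_eq_nat_card_basis (Module.Basis.mk hli fun u _ => key _ u rfl)]
  exact Nat.card_coe_set_eq _

/-- The leading exponents of the graded pieces of a monomial ideal. -/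
theorem leadExps_span_monomial (m : MonomialOrder σ) (S : Set (σ →₀ ℕ)) (j : ℕ) :
    leadExps m ((Ideal.span ((fun s => monomial s (1 : k)) '' S)).restrictScalars k ⊓
      homogeneousSubmodule σ k j) = {a | a.degree = j ∧ ∃ s ∈ S, s ≤ a} := by
  classical
  ext a
  constructor
  · rintro ⟨f, ⟨hfI, hfj⟩, hf0, rfl⟩
    have hs := m.degree_mem_support hf0
    refine ⟨?_, mem_ideal_span_monomial_image.1 hfI _ hs⟩
    have := (mem_homogeneousSubmodule j f).1 hfj (mem_support_iff.1 hs)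
    rwa [Finsupp.degree_eq_weight_one]
  · rintro ⟨hj, hs⟩
    refine ⟨monomial a 1, ⟨?_, ?_⟩, by simp, by rw [m.degree_monomial]; simp⟩
    · refine mem_ideal_span_monomial_image.2 fun x hx => ?_
      rw [support_monomial] at hx
      simp only [one_ne_zero, if_false, Finset.mem_singleton] at hx
      rwa [hx]
    · exact isHomogeneous_monomial 1 hj

/-- The leading exponents of an ideal are closed under adding exponents. -/
theorem add_mem_leadExps (m : MonomialOrder σ) (I : Ideal (MvPolynomial σ k)) {i j : ℕ}
    {a b : σ →₀ ℕ} (hb : b.degree = j)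
    (ha : a ∈ leadExps m (I.restrictScalars k ⊓ homogeneousSubmodule σ k i)) :
    b + a ∈ leadExps m (I.restrictScalars k ⊓ homogeneousSubmodule σ k (j + i)) := by
  classical
  obtain ⟨f, ⟨hfI, hfi⟩, hf0, rfl⟩ := ha
  have hm0 : (monomial b 1 : MvPolynomial σ k) ≠ 0 := by simp
  refine ⟨monomial b 1 * f, ⟨I.mul_mem_left _ hfI, ?_⟩, mul_ne_zero hm0 hf0, ?_⟩
  · exact (isHomogeneous_monomial 1 hb).mul hfi
  · rw [m.degree_mul hm0 hf0, m.degree_monomial]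
    simp

theorem leadExps_degree (m : MonomialOrder σ) (U : Submodule k (MvPolynomial σ k)) {j : ℕ}
    {a : σ →₀ ℕ} (ha : a ∈ leadExps m (U ⊓ homogeneousSubmodule σ k j)) : a.degree = j := by
  obtain ⟨f, ⟨-, hfj⟩, hf0, rfl⟩ := ha
  have := (mem_homogeneousSubmodule j f).1 hfj (mem_support_iff.1 (m.degree_mem_support hf0))
  rwa [Finsupp.degree_eq_weight_one]

end LeadingExponents

/-! ### Square-free exponents and upper shadows -/

section SquarefreeExponents

variable {n : ℕ}

/-- The exponent of the square-free monomial `∏ i ∈ F, X i`. -/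
noncomputable def sqfreeExp (F : Finset (Fin n)) : Fin n →₀ ℕ :=
  ∑ i ∈ F, Finsupp.single i 1

theorem sqfreeExp_apply (F : Finset (Fin n)) (i : Fin n) :
    sqfreeExp F i = if i ∈ F then 1 else 0 := by
  simp [sqfreeExp, Finsupp.finsetSum_apply, Finsupp.single_apply]

theorem sqfreeExp_degree (F : Finset (Fin n)) : (sqfreeExp F).degree = F.card := by
  simp [sqfreeExp, Finsupp.degree_single]

theorem sqfreeExp_le_iff {F G : Finset (Fin n)} : sqfreeExp F ≤ sqfreeExp G ↔ F ⊆ G := by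
  simp only [Finsupp.le_def, sqfreeExp_apply]
  refine forall_congr' fun i => ?_
  by_cases h : i ∈ F <;> by_cases h' : i ∈ G <;> simp [h, h']

theorem sqfreeExp_injective : Function.Injective (sqfreeExp (n := n)) := fun _ _ h =>
  Finset.Subset.antisymm (sqfreeExp_le_iff.1 h.le) (sqfreeExp_le_iff.1 h.ge)

theorem sqfreeExp_insert {F : Finset (Fin n)} {i : Fin n} (hi : i ∉ F) :
    sqfreeExp (insert i F) = Finsupp.single i 1 + sqfreeExp F := by
  simp [sqfreeExp, Finset.sum_insert hi]

theorem mem_range_sqfreeExp_iff {a : Fin n →₀ ℕ} :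
    a ∈ Set.range sqfreeExp ↔ ∀ i, ¬ Finsupp.single i 2 ≤ a := by
  constructor
  · rintro ⟨F, rfl⟩ i h
    have := h i
    rw [Finsupp.single_eq_same, sqfreeExp_apply] at this
    split_ifs at this <;> omega
  · intro h
    refine ⟨a.support, Finsupp.ext fun i => ?_⟩
    have hi := h i
    rw [Finsupp.single_le_iff] at hi
    rw [sqfreeExp_apply]
    split_ifs with hs
    · rw [Finsupp.mem_support_iff] at hs
      omega
    · simpa using hs.imp_symm Finsupp.mem_support_iff.2 |>.symm

theorem prod_X_eq_monomial_sqfreeExp (k : Type*) [Field k] (F : Finset (Fin n)) :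
    ∏ i ∈ F, (X i : MvPolynomial (Fin n) k) = monomial (sqfreeExp F) 1 := by
  rw [sqfreeExp, monomial_sum_one]
  rfl

/-- The sets of cardinality `j` that contain a member of `T`. -/
def upperSets (T : Set (Finset (Fin n))) (j : ℕ) : Set (Finset (Fin n)) :=
  {G | G.card = j ∧ ∃ F ∈ T, F ⊆ G}

theorem upperSets_self {T : Set (Finset (Fin n))} {d : ℕ} (hT : ∀ F ∈ T, F.card = d) :
    upperSets T d = T := by
  ext G
  constructor
  · rintro ⟨hG, F, hF, hFG⟩
    rwa [← Finset.eq_of_subset_of_card_le hFG (by rw [hT F hF, hG])]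
  · exact fun h => ⟨hT G h, G, h, subset_rfl⟩

theorem exists_eq_insert_of_mem_upperSets {T : Set (Finset (Fin n))} {d : ℕ}
    (hT : ∀ F ∈ T, F.card = d) {G : Finset (Fin n)} (hG : G ∈ upperSets T (d + 1)) :
    ∃ F ∈ T, ∃ i ∉ F, G = insert i F := by
  obtain ⟨hc, F, hF, hFG⟩ := hG
  obtain ⟨i, hi, h⟩ := Finset.covBy_iff_exists_insert.1
    (Finset.covBy_iff_card_sdiff_eq_one.2 ⟨hFG, by
      rw [Finset.card_sdiff_of_subset hFG, hc, hT F hF]; omega⟩)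
  exact ⟨F, hF, i, hi, h.symm⟩

/-- Multiples of degree `d + 1` of square-free exponents of degree `d`: those that are not
square-free arise by doubling one index. -/
theorem ncard_multiples {T : Set (Finset (Fin n))} {d : ℕ} (hT : ∀ F ∈ T, F.card = d) :
    {a : Fin n →₀ ℕ | a.degree = d + 1 ∧ ∃ s ∈ sqfreeExp '' T, s ≤ a}.ncard =
      d * T.ncard + (upperSets T (d + 1)).ncard := by
  classical
  let D : Finset (Σ _ : Finset (Fin n), Fin n) := T.toFinset.sigma fun F => F
  let φ : (Σ _ : Finset (Fin n), Fin n) → (Fin n →₀ ℕ) :=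
    fun p => Finsupp.single p.2 1 + sqfreeExp p.1
  have hφ : ∀ p ∈ D, ∀ i, 2 ≤ φ p i ↔ i = p.2 := by
    -- The doubled index is the only one with exponent at least 2, so it can be read off from `φ p`;
    -- this makes `φ` injective on `D`.
    intro p hp i
    have hp2 := (Finset.mem_sigma.1 hp).2
    simp only [φ, Finsupp.add_apply, sqfreeExp_apply, Finsupp.single_apply]
    by_cases h : p.2 = i
    · subst h
      simp [hp2]
    · have h' : i ≠ p.2 := fun e => h e.symm
      simp only [h, h', if_false, iff_false]
      split_ifs <;> omega
  have hinj : Set.InjOn φ D := by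
    intro p hp q hq h
    have h2 : p.2 = q.2 := (hφ q hq _).1 (h ▸ (hφ p hp _).2 rfl)
    have h1 : p.1 = q.1 := by
      apply sqfreeExp_injective
      have h' : Finsupp.single p.2 1 + sqfreeExp p.1 = Finsupp.single q.2 1 + sqfreeExp q.1 := h
      rw [h2] at h'
      exact add_left_cancel h'
    exact Sigma.ext h1 (heq_of_eq h2)
  have hD : (φ '' D).ncard = d * T.ncard := by
    rw [hinj.ncard_image, Set.ncard_coe_finset, Finset.card_sigma,
      Finset.sum_congr rfl fun F hF => hT F (Set.mem_toFinset.1 hF), Finset.sum_const,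
      smul_eq_mul, mul_comm, Set.ncard_eq_toFinset_card']
  have hset : {a : Fin n →₀ ℕ | a.degree = d + 1 ∧ ∃ s ∈ sqfreeExp '' T, s ≤ a} =
      φ '' D ∪ sqfreeExp '' upperSets T (d + 1) := by
    ext a
    constructor
    · rintro ⟨ha, _, ⟨F, hF, rfl⟩, hle⟩
      obtain ⟨c, rfl⟩ := exists_add_of_le hle
      rw [map_add, sqfreeExp_degree, hT F hF, add_right_inj] at ha
      have hc : c ∈ Set.range fun i : Fin n => Finsupp.single i 1 := by
        rw [Finsupp.range_single_one]
        exact ha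
      obtain ⟨i, rfl⟩ := hc
      by_cases hi : i ∈ F
      · exact Or.inl ⟨⟨F, i⟩, Finset.mem_sigma.2 ⟨Set.mem_toFinset.2 hF, hi⟩, add_comm _ _⟩
      · refine Or.inr ⟨insert i F, ⟨?_, F, hF, Finset.subset_insert _ _⟩, ?_⟩
        · rw [Finset.card_insert_of_notMem hi, hT F hF]
        · rw [sqfreeExp_insert hi]
          exact add_comm _ _
    · rintro (⟨p, hp, rfl⟩ | ⟨G, ⟨hG, F, hF, hFG⟩, rfl⟩)
      · have hp1 := Set.mem_toFinset.1 (Finset.mem_sigma.1 hp).1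
        refine ⟨?_, _, ⟨p.1, hp1, rfl⟩, le_add_self⟩
        simp only [φ, map_add, Finsupp.degree_single, sqfreeExp_degree, hT _ hp1]
        omega
      · exact ⟨by rw [sqfreeExp_degree, hG], _, ⟨F, hF, rfl⟩, sqfreeExp_le_iff.2 hFG⟩
  have hdisj : Disjoint (φ '' D) (sqfreeExp '' upperSets T (d + 1)) := by
    rw [Set.disjoint_left]
    rintro _ ⟨p, hp, rfl⟩ ⟨G, -, hG⟩
    refine mem_range_sqfreeExp_iff.1 ⟨G, hG⟩ p.2 ?_
    rw [Finsupp.single_le_iff]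
    exact (hφ p hp _).2 rfl
  rw [hset, Set.ncard_union_eq hdisj (D.finite_toSet.image _) ((Set.toFinite _).image _), hD,
    Set.ncard_image_of_injective _ sqfreeExp_injective]

end SquarefreeExponents

/-! ### Square-free monomial ideals and Hilbert functions in the Kruskal-Katona ring -/

section SquarefreeIdeals

variable (k : Type*) [Field k] {n : ℕ}

/-- The ideal generated by the square-free monomials with supports in `T`. -/
noncomputable def sqfreeIdeal (T : Set (Finset (Fin n))) : Ideal (MvPolynomial (Fin n) k) :=
  Ideal.span ((fun s => monomial s (1 : k)) '' (sqfreeExp '' T))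

theorem span_prod_X_eq_sqfreeIdeal (T : Set (Finset (Fin n))) :
    Ideal.span ((fun F : Finset (Fin n) => ∏ i ∈ F, (X i : MvPolynomial (Fin n) k)) '' T) =
      sqfreeIdeal k T := by
  simp only [sqfreeIdeal, Set.image_image, prod_X_eq_monomial_sqfreeExp]

theorem squaresIdeal_eq_span_monomial :
    squaresIdeal k n = Ideal.span ((fun s => monomial s (1 : k)) ''
      Set.range fun i : Fin n => Finsupp.single i 2) := by
  rw [squaresIdeal, ← Set.range_comp]
  congr 2
  funext i
  exact X_pow_eq_monomial

theorem sqfreeIdeal_isHomogeneous (T : Set (Finset (Fin n))) :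
    (sqfreeIdeal k T).IsHomogeneous (homogeneousSubmodule (Fin n) k) := by
  refine Ideal.homogeneous_span _ _ ?_
  rintro _ ⟨s, -, rfl⟩
  exact ⟨s.degree, isHomogeneous_monomial 1 rfl⟩

theorem hilbertFunction_sqfreeIdeal {T : Set (Finset (Fin n))} {d : ℕ}
    (hT : ∀ F ∈ T, F.card = d) :
    hilbertFunction (homogeneousSubmodule (Fin n) k) (sqfreeIdeal k T) d = T.ncard := by
  rw [hilbertFunction, finrank_eq_ncard_leadExps MonomialOrder.lex, sqfreeIdeal,
    leadExps_span_monomial, ← Set.ncard_image_of_injective T sqfreeExp_injective]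
  congr 1
  ext a
  constructor
  · rintro ⟨ha, _, ⟨F, hF, rfl⟩, hle⟩
    obtain ⟨c, rfl⟩ := exists_add_of_le hle
    rw [map_add, sqfreeExp_degree, hT F hF, Nat.add_eq_left, Finsupp.degree_eq_zero_iff] at ha
    exact ⟨F, hF, by rw [ha, add_zero]⟩
  · rintro ⟨F, hF, rfl⟩
    exact ⟨by rw [sqfreeExp_degree, hT F hF], _, ⟨F, hF, rfl⟩, le_rfl⟩

theorem hilbertFunction_sqfreeIdeal_succ {T : Set (Finset (Fin n))} {d : ℕ}
    (hT : ∀ F ∈ T, F.card = d) :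
    hilbertFunction (homogeneousSubmodule (Fin n) k) (sqfreeIdeal k T) (d + 1) =
      d * T.ncard + (upperSets T (d + 1)).ncard := by
  rw [hilbertFunction, finrank_eq_ncard_leadExps MonomialOrder.lex, sqfreeIdeal,
    leadExps_span_monomial, ncard_multiples hT]

variable {k}

/-- The square-free leading exponents of the preimage of an ideal of the Kruskal-Katona ring. -/
def leadSets (J : Ideal (KruskalKatonaRing k n)) (j : ℕ) : Set (Finset (Fin n)) :=
  {F | sqfreeExp F ∈ leadExps MonomialOrder.lex
    ((J.comap (Ideal.Quotient.mk (squaresIdeal k n))).restrictScalars k ⊓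
      homogeneousSubmodule (Fin n) k j)}

theorem card_of_mem_leadSets {J : Ideal (KruskalKatonaRing k n)} {j : ℕ} {F : Finset (Fin n)}
    (hF : F ∈ leadSets J j) : F.card = j := by
  rw [← sqfreeExp_degree]
  exact leadExps_degree _ _ hF

/-- Multiplying by a variable `X i` with `i ∉ F` stays in the ideal and turns the leading set `F`
into `insert i F`. -/
theorem upperSets_leadSets_subset (J : Ideal (KruskalKatonaRing k n)) (d : ℕ) :
    upperSets (leadSets J d) (d + 1) ⊆ leadSets J (d + 1) := by
  intro G hG
  obtain ⟨F, hF, i, hi, rfl⟩ :=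
    exists_eq_insert_of_mem_upperSets (fun _ h => card_of_mem_leadSets h) hG
  change sqfreeExp _ ∈ leadExps _ _
  rw [sqfreeExp_insert hi, add_comm d]
  exact add_mem_leadExps _ _ (Finsupp.degree_single _ _) hF

/-- Rank-nullity for the quotient map onto the Kruskal-Katona ring. -/
theorem hilbertFunction_add_squaresIdeal (J : Ideal (KruskalKatonaRing k n)) (j : ℕ) :
    hilbertFunction (kruskalKatonaGrading k n) J j +
      hilbertFunction (homogeneousSubmodule (Fin n) k) (squaresIdeal k n) j =
      hilbertFunction (homogeneousSubmodule (Fin n) k)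
        (J.comap (Ideal.Quotient.mk (squaresIdeal k n))) j := by
  have hfin : Module.Finite k (homogeneousSubmodule (Fin n) k j) :=
    Module.Finite.iff_fg.2 (homogeneousSubmodule_fg _ _ j)
  let U : Submodule k (MvPolynomial (Fin n) k) :=
    (J.comap (Ideal.Quotient.mk (squaresIdeal k n))).restrictScalars k ⊓
      homogeneousSubmodule (Fin n) k j
  let π := (Ideal.Quotient.mkₐ k (squaresIdeal k n)).toLinearMap
  have hU : Module.Finite k U := Submodule.finiteDimensional_of_le inf_le_right
  have h := (π.domRestrict U).finrank_range_add_finrank_ker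
  have hr : LinearMap.range (π.domRestrict U) =
      J.restrictScalars k ⊓ kruskalKatonaGrading k n j := by
    ext q
    constructor
    · rintro ⟨⟨f, hfJ, hfj⟩, rfl⟩
      exact ⟨hfJ, f, hfj, rfl⟩
    · rintro ⟨hq, f, hf, rfl⟩
      exact ⟨⟨f, hq, hf⟩, rfl⟩
  have hk : Submodule.map U.subtype (LinearMap.ker (π.domRestrict U)) =
      (squaresIdeal k n).restrictScalars k ⊓ homogeneousSubmodule (Fin n) k j := by
    ext f
    constructor
    · rintro ⟨⟨g, hgJ, hgj⟩, hg, rfl⟩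
      exact ⟨Ideal.Quotient.eq_zero_iff_mem.1 hg, hgj⟩
    · rintro ⟨hf, hfj⟩
      have hf0 : Ideal.Quotient.mk (squaresIdeal k n) f = 0 := Ideal.Quotient.eq_zero_iff_mem.2 hf
      refine ⟨⟨f, ?_, hfj⟩, hf0, rfl⟩
      change Ideal.Quotient.mk (squaresIdeal k n) f ∈ J
      rw [hf0]
      exact J.zero_mem
  rw [hr, ← Submodule.finrank_map_subtype_eq, hk] at h
  exact h

/-- The Hilbert function of an ideal of the Kruskal-Katona ring counts square-free leading
monomials. -/
theorem hilbertFunction_eq_ncard_leadSets (J : Ideal (KruskalKatonaRing k n)) (j : ℕ) :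
    hilbertFunction (kruskalKatonaGrading k n) J j = (leadSets J j).ncard := by
  have h := hilbertFunction_add_squaresIdeal J j
  set L := leadExps MonomialOrder.lex
    ((J.comap (Ideal.Quotient.mk (squaresIdeal k n))).restrictScalars k ⊓
      homogeneousSubmodule (Fin n) k j)
  set N := leadExps MonomialOrder.lex ((squaresIdeal k n).restrictScalars k ⊓
      homogeneousSubmodule (Fin n) k j) with hN
  have h1 : hilbertFunction (homogeneousSubmodule (Fin n) k)
      (J.comap (Ideal.Quotient.mk (squaresIdeal k n))) j = L.ncard :=
    finrank_eq_ncard_leadExps _ _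
  have h2 : hilbertFunction (homogeneousSubmodule (Fin n) k) (squaresIdeal k n) j = N.ncard :=
    finrank_eq_ncard_leadExps _ _
  have hNL : N ⊆ L := by
    refine leadExps_mono _ (inf_le_inf_right _ fun f hf => ?_)
    change Ideal.Quotient.mk (squaresIdeal k n) f ∈ J
    rw [Ideal.Quotient.eq_zero_iff_mem.2 hf]
    exact J.zero_mem
  have hLfin : L.Finite :=
    (Finsupp.finite_of_degree_eq j).subset fun a ha => leadExps_degree _ _ ha
  -- `N` consists of all exponents of degree `j` that are not square-free.
  have hdiff : L \ N = sqfreeExp '' leadSets J j := by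
    rw [hN, squaresIdeal_eq_span_monomial, leadExps_span_monomial]
    ext a
    constructor
    · rintro ⟨haL, haN⟩
      obtain ⟨F, rfl⟩ := mem_range_sqfreeExp_iff.2 fun i hi =>
        haN ⟨leadExps_degree _ _ haL, _, ⟨i, rfl⟩, hi⟩
      exact ⟨F, haL, rfl⟩
    · rintro ⟨F, hF, rfl⟩
      refine ⟨hF, ?_⟩
      rintro ⟨-, _, ⟨i, rfl⟩, hi⟩
      exact mem_range_sqfreeExp_iff.1 ⟨F, rfl⟩ i hi
  have h3 := Set.ncard_sdiff_add_ncard_of_subset hNL hLfin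
  rw [hdiff, Set.ncard_image_of_injective _ sqfreeExp_injective] at h3
  omega

/-- The preimage of the image is the sum with the ideal of squares, again a monomial ideal, and no
square divides a square-free monomial. -/
theorem leadSets_map_sqfreeIdeal (T : Set (Finset (Fin n))) (j : ℕ) :
    leadSets ((sqfreeIdeal k T).map (Ideal.Quotient.mk (squaresIdeal k n))) j =
      upperSets T j := by
  ext G
  rw [leadSets, Ideal.comap_map_of_surjective' _ Ideal.Quotient.mk_surjective, Ideal.mk_ker,
    squaresIdeal_eq_span_monomial, sqfreeIdeal, ← Ideal.span_union, ← Set.image_union,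
    Set.mem_ofPred_eq, leadExps_span_monomial]
  constructor
  · rintro ⟨hG, _, ⟨F, hF, rfl⟩ | ⟨i, rfl⟩, hle⟩
    · exact ⟨by rwa [sqfreeExp_degree] at hG, F, hF, sqfreeExp_le_iff.1 hle⟩
    · exact (mem_range_sqfreeExp_iff.1 ⟨G, rfl⟩ i hle).elim
  · rintro ⟨hG, F, hF, hFG⟩
    exact ⟨by rwa [sqfreeExp_degree], _, Or.inl ⟨F, hF, rfl⟩, sqfreeExp_le_iff.2 hFG⟩

/-- A square-free monomial ideal generated in degree `d` is generated by square-free monomials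
of degree `d`. -/
theorem exists_eq_sqfreeIdeal {d : ℕ} {I : Ideal (MvPolynomial (Fin n) k)}
    (hI : IsSquarefreeMonomialIdeal I)
    (hd : IsGeneratedInDegree (homogeneousSubmodule (Fin n) k) d I) :
    ∃ T : Set (Finset (Fin n)), (∀ F ∈ T, F.card = d) ∧ I = sqfreeIdeal k T := by
  obtain ⟨S, hS⟩ := hI
  rw [span_prod_X_eq_sqfreeIdeal] at hS
  obtain ⟨S', hS', hI'⟩ := hd
  have hdeg : ∀ g ∈ S', ∀ x ∈ g.support, x.degree = d := fun g hg x hx => by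
    have := (mem_homogeneousSubmodule d g).1 (hS' hg) (mem_support_iff.1 hx)
    rwa [Finsupp.degree_eq_weight_one]
  have hle : I ≤ Ideal.span ((fun s => monomial s (1 : k)) '' {s | s.degree = d}) := by
    rw [hI', Ideal.span_le]
    exact fun g hg => mem_ideal_span_monomial_image.2 fun x hx => ⟨x, hdeg g hg x hx, le_rfl⟩
  have hcard : ∀ F ∈ S, d ≤ F.card := by
    intro F hF
    have hmem : monomial (sqfreeExp F) (1 : k) ∈ I := by
      rw [hS]
      exact Ideal.subset_span ⟨_, ⟨F, hF, rfl⟩, rfl⟩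
    obtain ⟨s, hs, hsF⟩ := mem_ideal_span_monomial_image.1 (hle hmem) (sqfreeExp F) (by simp)
    rw [← sqfreeExp_degree, ← show s.degree = d from hs]
    exact Finsupp.degree_mono hsF
  refine ⟨{F ∈ S | F.card = d}, fun F hF => hF.2, le_antisymm ?_ ?_⟩
  · rw [hI', Ideal.span_le]
    intro g hg
    have hgI : g ∈ sqfreeIdeal k S := by
      rw [← hS, hI']
      exact Ideal.subset_span hg
    refine mem_ideal_span_monomial_image.2 fun x hx => ?_
    obtain ⟨_, ⟨F, hF, rfl⟩, hFx⟩ := mem_ideal_span_monomial_image.1 hgI x hx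
    -- A generator dividing a monomial of degree `d` has degree at most `d`, and `hcard` gives the
    -- reverse bound.
    refine ⟨_, ⟨F, ⟨hF, le_antisymm ?_ (hcard F hF)⟩, rfl⟩, hFx⟩
    rw [← sqfreeExp_degree, ← hdeg g hg x hx]
    exact Finsupp.degree_mono hFx
  · rw [hS]
    exact Ideal.span_mono (Set.image_mono (Set.image_mono fun F hF => hF.1))

end SquarefreeIdeals

end Gotzmann

theorem mainTheorem5 (k : Type*) [Field k] (n d : ℕ) (I : Ideal (MvPolynomial (Fin n) k))
    (hI : Gotzmann.IsSquarefreeMonomialIdeal I)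
    (hG : Gotzmann.IsGotzmann (MvPolynomial.homogeneousSubmodule (Fin n) k) d I) :
    Gotzmann.IsGotzmann (Gotzmann.kruskalKatonaGrading k n) d
      (I.map (Ideal.Quotient.mk (Gotzmann.squaresIdeal k n))) := by
  obtain ⟨-, hgen, hmin⟩ := hG
  obtain ⟨T, hT, rfl⟩ := Gotzmann.exists_eq_sqfreeIdeal hI hgen
  obtain ⟨S, hS, hTS⟩ := hgen
  have hsub : (Ideal.Quotient.mk (Gotzmann.squaresIdeal k n)) '' S ⊆
      Gotzmann.kruskalKatonaGrading k n d := by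
    rintro _ ⟨f, hf, rfl⟩
    exact Gotzmann.mk_mem_quotientGrading _ _ (hS hf)
  have hmap : (Gotzmann.sqfreeIdeal k T).map (Ideal.Quotient.mk (Gotzmann.squaresIdeal k n)) =
      Ideal.span ((Ideal.Quotient.mk (Gotzmann.squaresIdeal k n)) '' S) := by
    rw [hTS, Ideal.map_span]
  refine ⟨?_, ⟨_, hsub, hmap⟩, fun J _ hJ => ?_⟩
  · rw [hmap]
    exact Ideal.homogeneous_span _ _ fun q hq => ⟨d, hsub hq⟩
  simp only [Gotzmann.hilbertFunction_eq_ncard_leadSets, Gotzmann.leadSets_map_sqfreeIdeal,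
    Gotzmann.upperSets_self hT] at hJ ⊢
  have hW : ∀ F ∈ Gotzmann.leadSets J d, F.card = d :=
    fun F hF => Gotzmann.card_of_mem_leadSets hF
  have h := hmin (Gotzmann.sqfreeIdeal k (Gotzmann.leadSets J d))
    (Gotzmann.sqfreeIdeal_isHomogeneous k _)
    (by rw [Gotzmann.hilbertFunction_sqfreeIdeal k hT, Gotzmann.hilbertFunction_sqfreeIdeal k hW,
      hJ])
  rw [Gotzmann.hilbertFunction_sqfreeIdeal_succ k hT,
    Gotzmann.hilbertFunction_sqfreeIdeal_succ k hW, hJ] at h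
  -- The equal non-square-free contributions `d * |W|` cancel, leaving the comparison of shadows.
  exact (Nat.le_of_add_le_add_left h).trans
    (Set.ncard_le_ncard (Gotzmann.upperSets_leadSets_subset J d) (Set.toFinite _))
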